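/- Let $n>1$ be an integer. Let $W(n)_{>0}$ be the space of real $n\times n$ matrices $B$ with $\det(B)>0$ all of whose columns are unit vectors in the Euclidean norm, with the topology of a subspace of the space of matrices. Let $G_0$ be the finite group of signed permutation matrices of determinant $1$, that is, of the matrices of determinant $1$ of the form $a\sigma$ with $a$ a diagonal matrix with diagonal entries $\pm1$ and $\sigma$ an $n\times n$ permutation matrix. The group $G_0$ acts on $W(n)_{>0}$ by matrix multiplication from the right; let $W(n)_{>0}/G_0$ be the orbit space with the quotient topology. Then there is an isomorphism of graded $\mathbb{Q}$-algebras $$H^*(W(n)_{>0}/G_0;\mathbb{Q})\simeq H^*(SO(n);\mathbb{Q}),$$ where $H^*(\,\cdot\,;\mathbb{Q})$ denotes singular cohomology with rational coefficients and the cup product, that is, there are $\mathbb{Q}$-linear isomorphisms $H^k(W(n)_{>0}/G_0;\mathbb{Q})\to H^k(SO(n);\mathbb{Q})$ for all $k\ge 0$ that together preserve the unit and the cup product. -/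

import Mathlib

open CategoryTheory

noncomputable section

namespace SingularCohomology

section SimplicialCochains

variable (R : Type) [CommRing R] (S : SSet.{0})

/-- `R`-valued `k`-cochains of a simplicial set. -/
abbrev Cochain (k : ℕ) : Type := S.obj (Opposite.op (SimplexCategory.mk k)) → R

/-- The coboundary `(dφ)(σ) = ∑ i, (-1)^i φ(∂ᵢσ)`. -/
def d (k : ℕ) : Cochain R S k →ₗ[R] Cochain R S (k + 1) where
  toFun φ := fun σ => ∑ i : Fin (k + 2), (-1 : R) ^ (i : ℕ) * φ (S.map (SimplexCategory.δ i).op σ)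
  map_add' φ ψ := by
    funext σ
    simp [mul_add, Finset.sum_add_distrib]
  map_smul' c φ := by
    funext σ
    simp [Finset.mul_sum, mul_left_comm]

/-- The `k`-cocycles. -/
def cocycles (k : ℕ) : Submodule R (Cochain R S k) := LinearMap.ker (d R S k)

/-- The `k`-coboundaries; in degree `0` only the zero cochain. -/
def coboundaries : (k : ℕ) → Submodule R (Cochain R S k)
  | 0 => ⊥
  | k + 1 => LinearMap.range (d R S k)

/-- Cocycles modulo coboundaries. -/
abbrev SCohomology (k : ℕ) : Type :=
  cocycles R S k ⧸ (coboundaries R S k).submoduleOf (cocycles R S k)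

variable {R S}

/-- The cup product of cochains: `φ` on the front `p`-face (vertices `0, …, p`) times `ψ` on the
back `q`-face (vertices `p, …, p + q`). -/
def cochainCup {p q n : ℕ} (h : p + q = n) (φ : Cochain R S p) (ψ : Cochain R S q) :
    Cochain R S n := fun σ =>
  φ (S.map (SimplexCategory.subinterval 0 p (by omega)).op σ) *
    ψ (S.map (SimplexCategory.subinterval p q h.le).op σ)

theorem subinterval_δ_of_lt {n a l : ℕ} (h : a + l ≤ n) (j : Fin (n + 2)) (hj : a + l < (j : ℕ)) :
    SimplexCategory.subinterval a l h ≫ SimplexCategory.δ j =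
      SimplexCategory.subinterval a l (by omega) := by
  ext x
  change (j.succAbove ⟨x.1 + a, _⟩ : ℕ) = x.1 + a
  have hx : x.1 < l + 1 := x.2
  simp only [Fin.succAbove, Fin.lt_def, Fin.val_castSucc]
  split_ifs <;> simp <;> omega

theorem subinterval_δ_of_ge {n a l : ℕ} (h : a + l ≤ n) (j : Fin (n + 2)) (hj : (j : ℕ) ≤ a) :
    SimplexCategory.subinterval a l h ≫ SimplexCategory.δ j =
      SimplexCategory.subinterval (a + 1) l (by omega) := by
  ext x
  change (j.succAbove ⟨x.1 + a, _⟩ : ℕ) = x.1 + (a + 1)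
  have hx : x.1 < l + 1 := x.2
  simp only [Fin.succAbove, Fin.lt_def, Fin.val_castSucc]
  split_ifs <;> simp <;> omega

theorem subinterval_δ_shift {n a l : ℕ} (h : a + l ≤ n) (i : Fin (l + 2)) (j : Fin (n + 2))
    (hij : (j : ℕ) = a + i) :
    SimplexCategory.subinterval a l h ≫ SimplexCategory.δ j =
      SimplexCategory.δ i ≫ SimplexCategory.subinterval a (l + 1) (by omega) := by
  ext x
  change (j.succAbove ⟨x.1 + a, _⟩ : ℕ) = (i.succAbove x : ℕ) + a
  have hx : x.1 < l + 1 := x.2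
  simp only [Fin.succAbove, Fin.lt_def, Fin.val_castSucc]
  split_ifs <;> simp <;> omega

/-- The Leibniz rule `d(φ ⌣ ψ) = dφ ⌣ ψ + (-1)^p φ ⌣ dψ`. -/
theorem d_cochainCup {p q n : ℕ} (h : p + q = n) (φ : Cochain R S p) (ψ : Cochain R S q) :
    d R S n (cochainCup h φ ψ) =
      cochainCup (by omega) (d R S p φ) ψ +
        (-1 : R) ^ p • cochainCup (by omega) φ (d R S q ψ) := by
  subst h
  funext σ
  have key : ∀ f : Fin (p + q + 2) → R, ∑ i, f i =
      ∑ i : Fin (p + 1), f ⟨i, by omega⟩ + ∑ i : Fin (q + 1), f ⟨p + 1 + i, by omega⟩ := by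
    intro f
    have e : p + 1 + (q + 1) = p + q + 2 := by omega
    rw [← Equiv.sum_comp (finCongr e) f, Fin.sum_univ_add]
    rfl
  have mm : ∀ {a b c : ℕ} (f : SimplexCategory.mk a ⟶ SimplexCategory.mk b)
      (g : SimplexCategory.mk b ⟶ SimplexCategory.mk c) (τ : S.obj (Opposite.op (.mk c))),
      S.map f.op (S.map g.op τ) = S.map (f ≫ g).op τ := by
    intro a b c f g τ
    simp
  simp only [d, LinearMap.coe_mk, AddHom.coe_mk, cochainCup, Pi.add_apply, Pi.smul_apply,
    smul_eq_mul, mm]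
  rw [key, Fin.sum_univ_castSucc (n := p + 1), Fin.sum_univ_succ (n := q + 1)]
  have h1 : ∀ i : Fin (p + 1),
      SimplexCategory.subinterval 0 p (by omega) ≫
        SimplexCategory.δ (⟨i, by omega⟩ : Fin (p + q + 2)) =
      SimplexCategory.δ i.castSucc ≫ SimplexCategory.subinterval 0 (p + 1) (by omega) :=
    fun i => subinterval_δ_shift (by omega) _ _ (by simp)
  have h2 : ∀ i : Fin (p + 1),
      SimplexCategory.subinterval p q le_rfl ≫
        SimplexCategory.δ (⟨i, by omega⟩ : Fin (p + q + 2)) =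
      SimplexCategory.subinterval (p + 1) q (by omega) :=
    fun i => subinterval_δ_of_ge _ _ (by simp; omega)
  have h3 : ∀ i : Fin (q + 1),
      SimplexCategory.subinterval 0 p (by omega) ≫
        SimplexCategory.δ (⟨p + 1 + i, by omega⟩ : Fin (p + q + 2)) =
      SimplexCategory.subinterval 0 p (by omega) :=
    fun i => subinterval_δ_of_lt _ _ (by simp; omega)
  have h4 : ∀ i : Fin (q + 1),
      SimplexCategory.subinterval p q le_rfl ≫
        SimplexCategory.δ (⟨p + 1 + i, by omega⟩ : Fin (p + q + 2)) =
      SimplexCategory.δ i.succ ≫ SimplexCategory.subinterval p (q + 1) (by omega) :=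
    fun i => subinterval_δ_shift _ _ _ (by simp; omega)
  have h5 : SimplexCategory.δ (Fin.last (p + 1)) ≫
        SimplexCategory.subinterval 0 (p + 1) (by omega) =
      SimplexCategory.subinterval (n := p + q + 1) 0 p (by omega) := by
    rw [← subinterval_δ_shift (n := p + q) (by omega) (Fin.last (p + 1)) ⟨p + 1, by omega⟩
      (by simp)]
    exact subinterval_δ_of_lt _ _ (by simp)
  have h6 : SimplexCategory.δ (0 : Fin (q + 2)) ≫
        SimplexCategory.subinterval p (q + 1) (by omega) =
      SimplexCategory.subinterval (n := p + q + 1) (p + 1) q (by omega) := by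
    rw [← subinterval_δ_shift (n := p + q) (by omega) (0 : Fin (q + 2)) ⟨p, by omega⟩
      (by simp)]
    exact subinterval_δ_of_ge _ _ (by simp)
  simp only [h1, h2, h3, h4, h5, h6, add_mul, mul_add, Finset.sum_mul, Finset.mul_sum,
    Fin.val_castSucc, Fin.val_last, Fin.val_zero, Fin.val_succ]
  have e1 : ∀ i : Fin (q + 1), (-1 : R) ^ (p + 1 + (i : ℕ)) = (-1) ^ p * (-1) ^ ((i : ℕ) + 1) :=
    fun i => by ring
  simp only [e1]
  have e2 : (-1 : R) ^ (p + 1) = - (-1) ^ p := by ring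
  rw [e2]
  simp only [pow_zero, one_mul, neg_mul, mul_assoc, mul_left_comm (φ _)]
  ring

theorem cochainCup_mem_cocycles {p q n : ℕ} (h : p + q = n) {φ : Cochain R S p}
    {ψ : Cochain R S q} (hφ : φ ∈ cocycles R S p) (hψ : ψ ∈ cocycles R S q) :
    cochainCup h φ ψ ∈ cocycles R S n := by
  have hφ' : d R S p φ = 0 := hφ
  have hψ' : d R S q ψ = 0 := hψ
  change d R S n _ = 0
  rw [d_cochainCup, hφ', hψ']
  funext σ
  simp [cochainCup]

theorem cochainCup_mem_coboundaries_left {p q n : ℕ} (h : p + q = n) {φ : Cochain R S p}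
    {ψ : Cochain R S q} (hφ : φ ∈ coboundaries R S p) (hψ : ψ ∈ cocycles R S q) :
    cochainCup h φ ψ ∈ coboundaries R S n := by
  have hψ' : d R S q ψ = 0 := hψ
  cases p with
  | zero =>
    have h0 : φ = 0 := by simpa [coboundaries] using hφ
    have : cochainCup h φ ψ = 0 := by
      funext σ
      simp [cochainCup, h0]
    rw [this]
    exact zero_mem _
  | succ p =>
    obtain ⟨θ, rfl⟩ := hφ
    obtain ⟨m, rfl⟩ : ∃ m, n = m + 1 := ⟨p + q, by omega⟩
    refine ⟨cochainCup (by omega) θ ψ, ?_⟩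
    rw [d_cochainCup, hψ']
    funext σ
    simp [cochainCup]

theorem cochainCup_mem_coboundaries_right {p q n : ℕ} (h : p + q = n) {φ : Cochain R S p}
    {ψ : Cochain R S q} (hφ : φ ∈ cocycles R S p) (hψ : ψ ∈ coboundaries R S q) :
    cochainCup h φ ψ ∈ coboundaries R S n := by
  have hφ' : d R S p φ = 0 := hφ
  cases q with
  | zero =>
    have h0 : ψ = 0 := by simpa [coboundaries] using hψ
    have : cochainCup h φ ψ = 0 := by
      funext σ
      simp [cochainCup, h0]
    rw [this]
    exact zero_mem _
  | succ q =>
    obtain ⟨θ, rfl⟩ := hψ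
    obtain ⟨m, rfl⟩ : ∃ m, n = m + 1 := ⟨p + q, by omega⟩
    refine ⟨(-1 : R) ^ p • cochainCup (by omega) φ θ, ?_⟩
    rw [map_smul, d_cochainCup, hφ', smul_add, smul_smul, ← mul_pow]
    funext σ
    simp [cochainCup]

/-- The cup product on cohomology, induced by the cup product of cocycles. -/
def cup {p q : ℕ} : SCohomology R S p → SCohomology R S q → SCohomology R S (p + q) :=
  Quotient.map₂
    (fun φ ψ => ⟨cochainCup rfl φ.1 ψ.1, cochainCup_mem_cocycles rfl φ.2 ψ.2⟩) (by
      intro φ φ' hφ ψ ψ' hψ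
      have h1 : (φ - φ' : Cochain R S p) ∈ coboundaries R S p :=
        (Submodule.quotientRel_def ((coboundaries R S p).submoduleOf (cocycles R S p))).1 hφ
      have h2 : (ψ - ψ' : Cochain R S q) ∈ coboundaries R S q :=
        (Submodule.quotientRel_def ((coboundaries R S q).submoduleOf (cocycles R S q))).1 hψ
      refine (Submodule.quotientRel_def _).2 ?_
      change cochainCup rfl φ.1 ψ.1 - cochainCup rfl φ'.1 ψ'.1 ∈ coboundaries R S (p + q)
      have e : cochainCup rfl φ.1 ψ.1 - cochainCup rfl φ'.1 ψ'.1 =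
          cochainCup rfl (φ.1 - φ'.1) ψ.1 + cochainCup rfl φ'.1 (ψ.1 - ψ'.1) := by
        funext σ
        simp only [cochainCup, Pi.add_apply, Pi.sub_apply]
        ring
      rw [e]
      exact add_mem (cochainCup_mem_coboundaries_left rfl h1 ψ.2)
        (cochainCup_mem_coboundaries_right rfl φ'.2 h2))

variable (R S)

/-- The unit of the cohomology algebra: the class of the constant `0`-cochain `1`. -/
def unit : SCohomology R S 0 :=
  Submodule.Quotient.mk ⟨fun _ => 1, by
    change d R S 0 _ = 0
    funext σ
    simp [d, Fin.sum_univ_two]⟩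

end SimplicialCochains

/-- Singular cohomology `H^k(X; ℚ)`: the cohomology of the rational cochains on the singular
simplicial set of `X`, whose `k`-simplices are the continuous maps from the standard topological
`k`-simplex to `X`. -/
abbrev RatCohomology (X : Type) [TopologicalSpace X] (k : ℕ) : Type :=
  SCohomology ℚ (TopCat.toSSet.obj (TopCat.of X)) k

end SingularCohomology

namespace UnitColumns

/-- `W(n)`: real `n × n` matrices all of whose columns have Euclidean length one. -/
def W (n : ℕ) : Set (Matrix (Fin n) (Fin n) ℝ) :=
  {B | ∀ j, ‖WithLp.toLp 2 (B.col j)‖ = 1}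

/-- `W(n)_{>0}`, with the subspace topology of the space of matrices. -/
abbrev WPos (n : ℕ) : Type := {B : Matrix (Fin n) (Fin n) ℝ // B ∈ W n ∧ 0 < B.det}

/-- The matrix `aσ`, with `a` diagonal with entries `±1` and `σ` a permutation matrix. -/
def signedPerm {n : ℕ} (a : Fin n → ℤˣ) (σ : Equiv.Perm (Fin n)) : Matrix (Fin n) (Fin n) ℝ :=
  Matrix.diagonal (fun i => ((a i : ℤ) : ℝ)) * σ.permMatrix ℝ

theorem signedPerm_apply {n : ℕ} (a : Fin n → ℤˣ) (σ : Equiv.Perm (Fin n)) (i j : Fin n) :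
    signedPerm a σ i j = if σ i = j then ((a i : ℤ) : ℝ) else 0 := by
  simp [signedPerm, Matrix.diagonal_mul, Equiv.Perm.permMatrix, PEquiv.toMatrix_apply,
    eq_comm]

theorem signedPerm_mul {n : ℕ} (a b : Fin n → ℤˣ) (σ τ : Equiv.Perm (Fin n)) :
    signedPerm a σ * signedPerm b τ = signedPerm (fun i => a i * b (σ i)) (τ * σ) := by
  ext i j
  rw [Matrix.mul_apply, Finset.sum_eq_single (σ i)]
  · simp [signedPerm_apply]
  · intro x _ hx
    simp [signedPerm_apply, hx.symm]
  · simp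

theorem signedPerm_one {n : ℕ} : signedPerm (1 : Fin n → ℤˣ) 1 = 1 := by
  ext i j
  simp [signedPerm_apply, Matrix.one_apply]

/-- The group `G` of signed permutation matrices. -/
def G (n : ℕ) : Subgroup (GL (Fin n) ℝ) where
  carrier := {g | ∃ a σ, (g : Matrix (Fin n) (Fin n) ℝ) = signedPerm a σ}
  mul_mem' := by
    rintro g h ⟨a, σ, hg⟩ ⟨b, τ, hh⟩
    exact ⟨_, _, by rw [Units.val_mul, hg, hh, signedPerm_mul]⟩
  one_mem' := ⟨1, 1, by rw [signedPerm_one]; rfl⟩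
  inv_mem' := by
    rintro g ⟨a, σ, hg⟩
    refine ⟨fun i => a (σ⁻¹ i), σ⁻¹, ?_⟩
    refine Units.inv_eq_of_mul_eq_one_right ?_
    rw [hg, signedPerm_mul, ← signedPerm_one]
    congr 1
    · funext i
      simp
    · simp

/-- The subgroup `G₀ ⊆ G` of the elements of determinant one. -/
def G₀ (n : ℕ) : Subgroup (GL (Fin n) ℝ) := G n ⊓ (Matrix.GeneralLinearGroup.det).ker

theorem mul_mem_WPos {n : ℕ} {B : Matrix (Fin n) (Fin n) ℝ} (hB : B ∈ W n ∧ 0 < B.det)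
    {g : GL (Fin n) ℝ} (hg : g ∈ G₀ n) : B * g.1 ∈ W n ∧ 0 < (B * g.1).det := by
  obtain ⟨⟨a, σ, ha⟩, hdet⟩ := hg
  have hdet' : g.1.det = 1 := by
    simpa using congrArg Units.val (MonoidHom.mem_ker.1 hdet)
  refine ⟨fun j => ?_, by rw [Matrix.det_mul, hdet', mul_one]; exact hB.2⟩
  have hcol : WithLp.toLp 2 ((B * g.1).col j) =
      ((a (σ⁻¹ j) : ℤ) : ℝ) • WithLp.toLp 2 (B.col (σ⁻¹ j)) := by
    ext i
    simp only [ha, Matrix.col_apply, Matrix.mul_apply, signedPerm_apply, PiLp.smul_apply,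
      smul_eq_mul]
    rw [Finset.sum_eq_single (σ⁻¹ j)]
    · simp [mul_comm]
    · intro b _ hb
      rw [if_neg, mul_zero]
      rintro rfl
      simp at hb
    · simp
  rw [hcol, norm_smul, hB.1]
  rcases Int.units_eq_one_or (a (σ⁻¹ j)) with h | h <;> rw [h] <;> simp

/-- The right action of `G₀` on `W(n)_{>0}` by matrix multiplication `B ↦ B g`, as an action of
the opposite group. -/
instance (n : ℕ) : MulAction (G₀ n)ᵐᵒᵖ (WPos n) where
  smul g B := ⟨B.1 * g.unop.1.1, mul_mem_WPos B.2 g.unop.2⟩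
  one_smul B := Subtype.ext (Matrix.mul_one B.1)
  mul_smul g h B := Subtype.ext (Matrix.mul_assoc B.1 h.unop.1.1 g.unop.1.1).symm

/-- The orbit space `W(n)_{>0} / G₀`, with the quotient topology. -/
abbrev WPosQuot (n : ℕ) : Type := MulAction.orbitRel.Quotient (G₀ n)ᵐᵒᵖ (WPos n)

end UnitColumns

end

/-! The isomorphism is pullback along the composite SO(n) → W(n)_{>0} → W(n)_{>0}/G₀, so unit and
cup product are preserved by naturality and only bijectivity needs proof. Both factors induce
bijections on rational cohomology.

For the inclusion (`bijective_pullback_incl`): Gram–Schmidt retracts W(n)_{>0} onto SO(n). The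
segment from B to its orthonormalization keeps positive determinant, and rescaling columns turns it
into a homotopy inside W(n)_{>0}.

For the projection (`bijective_pullback_of_isQuotientCoveringMap`): G₀ is finite and acts freely, so
the projection is a covering. Singular simplices lift, uniquely up to the group, and averaging
cochains over the group, possible over ℚ, identifies the cohomology of the quotient with that of the
total space once the group acts trivially on the latter.

Triviality (`pullback_smulMap`) comes from `joinedIn_one_of_mem_G₀`: each element of G₀ is a product
of reflections with determinant one, and a product of two reflections can be deformed to the
identity inside SO(n) because nonzero vectors form a path-connected set when n > 1. -/

noncomputable section

namespace SingularCohomology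

/-! ### Functoriality of the cohomology algebra of simplicial sets -/

section Functoriality

variable {R : Type} [CommRing R] {S T U : SSet.{0}}

variable (R) in
/-- Pullback of cochains along a map of simplicial sets. -/
def cochainMap (f : S ⟶ T) (k : ℕ) : Cochain R T k →ₗ[R] Cochain R S k where
  toFun φ := fun σ => φ (f.app _ σ)
  map_add' _ _ := rfl
  map_smul' _ _ := rfl

theorem cochainMap_apply (f : S ⟶ T) (k : ℕ) (φ : Cochain R T k) (σ) :
    cochainMap R f k φ σ = φ (f.app _ σ) := rfl

theorem cochainMap_d (f : S ⟶ T) (k : ℕ) (φ : Cochain R T k) :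
    cochainMap R f (k + 1) (d R T k φ) = d R S k (cochainMap R f k φ) := by
  funext σ
  simp only [d, cochainMap, LinearMap.coe_mk, AddHom.coe_mk]
  refine Finset.sum_congr rfl fun i _ => ?_
  rw [NatTrans.naturality_apply]

theorem cochainMap_mem_cocycles (f : S ⟶ T) {k : ℕ} {φ : Cochain R T k}
    (hφ : φ ∈ cocycles R T k) : cochainMap R f k φ ∈ cocycles R S k := by
  have h : d R T k φ = 0 := hφ
  change d R S k _ = 0
  rw [← cochainMap_d, h, map_zero]

theorem cochainMap_mem_coboundaries (f : S ⟶ T) {k : ℕ} {φ : Cochain R T k}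
    (hφ : φ ∈ coboundaries R T k) : cochainMap R f k φ ∈ coboundaries R S k := by
  cases k with
  | zero =>
    have h0 : φ = 0 := by simpa [coboundaries] using hφ
    rw [h0, map_zero]
    exact zero_mem _
  | succ k =>
    obtain ⟨θ, rfl⟩ := hφ
    exact ⟨cochainMap R f k θ, (cochainMap_d f k θ).symm⟩

/-- The class of a cocycle. -/
def cls {k : ℕ} (φ : Cochain R S k) (hφ : φ ∈ cocycles R S k) : SCohomology R S k :=
  Submodule.Quotient.mk ⟨φ, hφ⟩

theorem cls_eq_cls {k : ℕ} {φ ψ : Cochain R S k} (hφ : φ ∈ cocycles R S k)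
    (hψ : ψ ∈ cocycles R S k) : cls φ hφ = cls ψ hψ ↔ φ - ψ ∈ coboundaries R S k :=
  Submodule.Quotient.eq _

theorem exists_cls_eq {k : ℕ} (a : SCohomology R S k) :
    ∃ (φ : Cochain R S k) (hφ : φ ∈ cocycles R S k), cls φ hφ = a := by
  obtain ⟨⟨φ, hφ⟩, rfl⟩ := Submodule.Quotient.mk_surjective _ a
  exact ⟨φ, hφ, rfl⟩

variable (R) in
/-- Pullback on cohomology along a map of simplicial sets. -/
def cohomologyMap (f : S ⟶ T) (k : ℕ) : SCohomology R T k →ₗ[R] SCohomology R S k :=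
  Submodule.mapQ _ _ ((cochainMap R f k).restrict fun _ h => cochainMap_mem_cocycles f h)
    fun _ h => cochainMap_mem_coboundaries f h

theorem cohomologyMap_cls (f : S ⟶ T) {k : ℕ} {φ : Cochain R T k} (hφ : φ ∈ cocycles R T k) :
    cohomologyMap R f k (cls φ hφ) = cls (cochainMap R f k φ) (cochainMap_mem_cocycles f hφ) := rfl

theorem cohomologyMap_id (k : ℕ) (a : SCohomology R S k) : cohomologyMap R (𝟙 S) k a = a := by
  obtain ⟨φ, hφ, rfl⟩ := exists_cls_eq a
  rfl

theorem cohomologyMap_comp (f : S ⟶ T) (g : T ⟶ U) (k : ℕ) (a : SCohomology R U k) :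
    cohomologyMap R (f ≫ g) k a = cohomologyMap R f k (cohomologyMap R g k a) := by
  obtain ⟨φ, hφ, rfl⟩ := exists_cls_eq a
  rfl

theorem cohomologyMap_unit (f : S ⟶ T) : cohomologyMap R f 0 (unit R T) = unit R S := rfl

theorem cohomologyMap_cup (f : S ⟶ T) {p q : ℕ} (a : SCohomology R T p) (b : SCohomology R T q) :
    cohomologyMap R f (p + q) (cup a b) = cup (cohomologyMap R f p a) (cohomologyMap R f q b) := by
  obtain ⟨φ, hφ, rfl⟩ := exists_cls_eq a
  obtain ⟨ψ, hψ, rfl⟩ := exists_cls_eq b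
  change cls (cochainMap R f (p + q) (cochainCup rfl φ ψ)) _ =
    cls (cochainCup rfl (cochainMap R f p φ) (cochainMap R f q ψ)) _
  congr 1
  funext σ
  simp only [cochainCup, cochainMap_apply]
  rw [NatTrans.naturality_apply, NatTrans.naturality_apply]

end Functoriality

/-! ### Homotopy invariance -/

section Homotopy

variable (R : Type) [CommRing R] {S T : SSet.{0}}

/-- The contravariant functor `X ↦ (X → R)`. -/
def funFunctor : Type ⥤ (ModuleCat.{0} R)ᵒᵖ where
  obj X := Opposite.op (ModuleCat.of R (X → R))
  map f := (ModuleCat.ofHom (LinearMap.funLeft R R f)).op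

/-- Evaluation of a morphism between function modules in the opposite category. -/
def evalUnop {A B : Type} (φ : A → R) (σ : B) :
    ((funFunctor R).obj B ⟶ (funFunctor R).obj A) →+ R :=
  AddMonoidHom.mk' (fun u => (u.unop.hom : (A → R) →ₗ[R] (B → R)) φ σ) fun _ _ => rfl

/-- Lets the general theorem on simplicial homotopies apply to the explicit coboundary. Evaluation
at φ and σ is additive, so it passes through the alternating sum, which is formed in the opposite
category with integer signs. -/
theorem funFunctor_d (k : ℕ) (φ : Cochain R S k) :
    (((AlgebraicTopology.alternatingFaceMapComplex (ModuleCat.{0} R)ᵒᵖ).obj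
      (((SimplicialObject.whiskering _ _).obj (funFunctor R)).obj S)).d (k + 1) k).unop.hom φ =
      d R S k φ := by
  rw [AlgebraicTopology.alternatingFaceMapComplex_obj_d,
    AlgebraicTopology.AlternatingFaceMapComplex.objD]
  funext σ
  refine (map_sum (evalUnop R φ σ) _ _).trans (Finset.sum_congr rfl fun i _ => ?_)
  refine (map_zsmul (evalUnop R φ σ) _ _).trans ?_
  have e : ((-1 : R) ^ (i : ℕ)) = (((-1 : ℤ) ^ (i : ℕ) : ℤ) : R) := by simp
  rw [e, ← zsmul_eq_mul]
  rfl

variable {R}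

/-- A simplicial homotopy induces a cochain homotopy. -/
theorem exists_cochain_homotopy {f g : S ⟶ T} (H : SimplicialObject.Homotopy f g) :
    ∃ h : ∀ k, Cochain R T (k + 1) →ₗ[R] Cochain R S k,
      (∀ φ, cochainMap R f 0 φ = h 0 (d R T 0 φ) + cochainMap R g 0 φ) ∧
      ∀ k φ, cochainMap R f (k + 1) φ =
        d R S k (h k φ) + h (k + 1) (d R T (k + 1) φ) + cochainMap R g (k + 1) φ := by
  -- A chain homotopy in the opposite of the module category is a cochain homotopy once its arrows
  -- are reversed.
  let K := (H.whiskerRight (funFunctor R)).toChainHomotopy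
  refine ⟨fun k => (K.hom k (k + 1)).unop.hom, fun φ => ?_, fun k φ => ?_⟩
  · have := K.comm 0
    rw [prevD_eq (j' := 1) (w := by simp), dNext_eq_zero _ _ (by simp), zero_add] at this
    have := congrArg (fun u => u.unop.hom φ) this
    refine this.trans (congrArg (· + cochainMap R g 0 φ) ?_)
    exact congrArg (K.hom 0 1).unop.hom (funFunctor_d R 0 φ)
  · have := K.comm (k + 1)
    rw [dNext_eq (i' := k) (w := by simp), prevD_eq (j' := k + 2) (w := by simp)] at this
    have := congrArg (fun u => u.unop.hom φ) this
    refine this.trans (congrArg (· + cochainMap R g (k + 1) φ) ?_)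
    exact congrArg₂ (· + ·) (funFunctor_d R k _)
      (congrArg (K.hom (k + 1) (k + 2)).unop.hom (funFunctor_d R (k + 1) φ))

theorem cohomologyMap_eq_of_homotopy {f g : S ⟶ T} (H : SimplicialObject.Homotopy f g) (k : ℕ) :
    cohomologyMap R f k = cohomologyMap R g k := by
  obtain ⟨h, h0, h1⟩ := exists_cochain_homotopy (R := R) H
  refine LinearMap.ext fun a => ?_
  obtain ⟨φ, hφ, rfl⟩ := exists_cls_eq a
  rw [cohomologyMap_cls, cohomologyMap_cls, cls_eq_cls]
  have hφ' : d R T k φ = 0 := hφ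
  cases k with
  | zero =>
    -- In degree 0 the only coboundary is zero, so the two pullbacks must agree as cochains, and
    -- they do on cocycles.
    rw [h0, hφ', map_zero, zero_add, sub_self]
    exact zero_mem _
  | succ k =>
    rw [h1, hφ', map_zero, add_zero, add_sub_cancel_right]
    exact ⟨_, rfl⟩

end Homotopy

/-! ### Pullback on singular cohomology of spaces -/

section Spaces

variable {X Y Z : Type} [TopologicalSpace X] [TopologicalSpace Y] [TopologicalSpace Z]

/-- The map of singular simplicial sets induced by a continuous map. -/
abbrev singularMap (f : C(X, Y)) :
    TopCat.toSSet.obj (TopCat.of X) ⟶ TopCat.toSSet.obj (TopCat.of Y) :=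
  TopCat.toSSet.map (TopCat.ofHom f)

/-- Pullback on rational singular cohomology. -/
def pullback (f : C(X, Y)) (k : ℕ) : RatCohomology Y k →ₗ[ℚ] RatCohomology X k :=
  cohomologyMap ℚ (singularMap f) k

theorem pullback_id (k : ℕ) (a : RatCohomology X k) : pullback (.id X) k a = a :=
  (congrArg (fun f => cohomologyMap ℚ f k a) (TopCat.toSSet.map_id (TopCat.of X))).trans
    (cohomologyMap_id k a)

theorem pullback_comp (g : C(Y, Z)) (f : C(X, Y)) (k : ℕ) (a : RatCohomology Z k) :
    pullback (g.comp f) k a = pullback f k (pullback g k a) :=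
  (congrArg (fun f => cohomologyMap ℚ f k a)
    (TopCat.toSSet.map_comp (TopCat.ofHom f) (TopCat.ofHom g))).trans (cohomologyMap_comp _ _ k a)

theorem pullback_unit (f : C(X, Y)) : pullback f 0 (unit _ _) = unit _ _ :=
  cohomologyMap_unit _

theorem pullback_cup (f : C(X, Y)) {p q : ℕ} (a : RatCohomology Y p) (b : RatCohomology Y q) :
    pullback f (p + q) (cup a b) = cup (pullback f p a) (pullback f q b) :=
  cohomologyMap_cup _ a b

theorem pullback_eq_of_homotopic {f g : C(X, Y)} (h : f.Homotopic g) (k : ℕ) :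
    pullback f k = pullback g k := by
  obtain ⟨H⟩ := h
  let H' : TopCat.Homotopy (TopCat.ofHom f) (TopCat.ofHom g) := H
  exact cohomologyMap_eq_of_homotopy H'.toSSet.toSimplicialObjectHomotopy k

end Spaces

end SingularCohomology

namespace SingularCohomology

/-! ### Averaging over a finite group -/

section Transfer

variable {S T : SSet.{0}} {G : Type} [Fintype G]

/-- The average of the translates of a cochain under a finite family of endomorphisms. -/
def average (a : G → (S ⟶ S)) (k : ℕ) : Cochain ℚ S k →ₗ[ℚ] Cochain ℚ S k :=
  (Fintype.card G : ℚ)⁻¹ • ∑ g, cochainMap ℚ (a g) k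

theorem average_eq (a : G → (S ⟶ S)) (k : ℕ) (ψ : Cochain ℚ S k) :
    average a k ψ = (Fintype.card G : ℚ)⁻¹ • ∑ g, cochainMap ℚ (a g) k ψ := by
  simp [average]

theorem average_apply (a : G → (S ⟶ S)) (k : ℕ) (ψ : Cochain ℚ S k) (σ) :
    average a k ψ σ = (Fintype.card G : ℚ)⁻¹ * ∑ g, ψ ((a g).app _ σ) := by
  rw [average_eq, Pi.smul_apply, Finset.sum_apply, smul_eq_mul]
  rfl

theorem d_average (a : G → (S ⟶ S)) (k : ℕ) (ψ : Cochain ℚ S k) :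
    d ℚ S k (average a k ψ) = average a (k + 1) (d ℚ S k ψ) := by
  simp only [average_eq, map_smul, map_sum, cochainMap_d]

theorem average_mem_cocycles (a : G → (S ⟶ S)) {k : ℕ} {ψ : Cochain ℚ S k}
    (hψ : ψ ∈ cocycles ℚ S k) : average a k ψ ∈ cocycles ℚ S k := by
  have h : d ℚ S k ψ = 0 := hψ
  change d ℚ S k _ = 0
  rw [d_average, h, map_zero]

/-- The difference is the mean of the cochains `cochainMap ℚ (a g) k ψ - ψ`, each a coboundary
because `a g` acts trivially on cohomology. -/
theorem cls_average [Nonempty G] (a : G → (S ⟶ S)) {k : ℕ} (ha : ∀ g, cohomologyMap ℚ (a g) k = .id)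
    {ψ : Cochain ℚ S k} (hψ : ψ ∈ cocycles ℚ S k) :
    cls (average a k ψ) (average_mem_cocycles a hψ) = cls ψ hψ := by
  rw [cls_eq_cls]
  have e : average a k ψ - ψ =
      (Fintype.card G : ℚ)⁻¹ • ∑ g, (cochainMap ℚ (a g) k ψ - ψ) := by
    have : (Fintype.card G : ℚ) ≠ 0 := by simp
    rw [average_eq, Finset.sum_sub_distrib, smul_sub, Finset.sum_const, Finset.card_univ,
      ← Nat.cast_smul_eq_nsmul ℚ, smul_smul, inv_mul_cancel₀ this, one_smul]
  rw [e]
  refine Submodule.smul_mem _ _ (Submodule.sum_mem _ fun g _ => ?_)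
  rw [← cls_eq_cls (cochainMap_mem_cocycles _ hψ) hψ, ← cohomologyMap_cls, ha]
  rfl

/-- If the fibres of `π` are the orbits of a finite group acting trivially on rational cohomology,
then `π` induces an isomorphism on rational cohomology. -/
theorem bijective_cohomologyMap_of_orbits [Group G] (π : S ⟶ T) (a : G → (S ⟶ S))
    (hmul : ∀ g h, a h ≫ a g = a (g * h)) (hπ : ∀ g, a g ≫ π = π)
    (hsurj : ∀ k, Function.Surjective (π.app k))
    (horb : ∀ k (τ τ' : S.obj k), π.app k τ = π.app k τ' → ∃ g, (a g).app k τ = τ')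
    (ha : ∀ g k, cohomologyMap ℚ (a g) k = .id) (k : ℕ) :
    Function.Bijective (cohomologyMap ℚ π k) := by
  have hinj : ∀ k, Function.Injective (cochainMap ℚ π k) := by
    intro k φ φ' h
    funext σ
    obtain ⟨τ, rfl⟩ := hsurj _ σ
    exact congrFun h τ
  -- An averaged cochain is invariant, hence constant on the fibres of π, so its value on any chosen
  -- lift defines a cochain downstairs.
  have hdesc : ∀ k (ψ : Cochain ℚ S k), ∃ φ, cochainMap ℚ π k φ = average a k ψ := by
    intro k ψ
    refine ⟨fun σ => average a k ψ (Function.surjInv (hsurj _) σ), ?_⟩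
    funext τ
    rw [cochainMap_apply]
    obtain ⟨h, hh⟩ := horb _ τ (Function.surjInv (hsurj _) (π.app _ τ))
      (Function.surjInv_eq (hsurj _) _).symm
    -- Invariance of the average: the sum over the group is reindexed by right translation by `h`.
    rw [← hh, average_apply, average_apply,
      ← Equiv.sum_comp (Equiv.mulRight h) (fun g => ψ ((a g).app _ τ))]
    congr 1
    refine Finset.sum_congr rfl fun g _ => ?_
    rw [Equiv.coe_mulRight, ← hmul]
    rfl
  have hfix : ∀ k φ, average a k (cochainMap ℚ π k φ) = cochainMap ℚ π k φ := by
    intro k φ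
    have : (Fintype.card G : ℚ) ≠ 0 := by simp
    have e : ∀ g, cochainMap ℚ (a g) k (cochainMap ℚ π k φ) = cochainMap ℚ π k φ := fun g =>
      congrArg (fun f => cochainMap ℚ f k φ) (hπ g)
    simp only [average_eq, e]
    rw [Finset.sum_const, Finset.card_univ,
      ← Nat.cast_smul_eq_nsmul ℚ, smul_smul, inv_mul_cancel₀ this, one_smul]
  constructor
  · rw [← LinearMap.ker_eq_bot, LinearMap.ker_eq_bot']
    intro x hx
    obtain ⟨φ, hφ, rfl⟩ := exists_cls_eq x
    have h0 : (0 : Cochain ℚ T k) ∈ cocycles ℚ T k := zero_mem _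
    have h0' : (0 : Cochain ℚ S k) ∈ cocycles ℚ S k := zero_mem _
    change _ = cls 0 h0
    change _ = cls 0 h0' at hx
    rw [cohomologyMap_cls, cls_eq_cls, sub_zero] at hx
    rw [cls_eq_cls, sub_zero]
    cases k with
    | zero =>
      have : cochainMap ℚ π 0 φ = 0 := by simpa [coboundaries] using hx
      rw [hinj 0 (this.trans (map_zero _).symm)]
      exact zero_mem _
    | succ k =>
      -- If π*φ = dψ, the average of ψ descends to θ. Averaging the equation, which fixes π*φ, gives
      -- π*φ = π*dθ, and π* is injective on cochains.
      obtain ⟨ψ, hψ⟩ := hx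
      obtain ⟨θ, hθ⟩ := hdesc k ψ
      refine ⟨θ, hinj _ ?_⟩
      rw [cochainMap_d, hθ, d_average, hψ, hfix]
  · intro x
    obtain ⟨ψ, hψ, rfl⟩ := exists_cls_eq x
    obtain ⟨φ, hφ⟩ := hdesc k ψ
    have hc : φ ∈ cocycles ℚ T k := by
      have h1 : d ℚ S k (average a k ψ) = 0 := average_mem_cocycles a hψ
      refine hinj (k + 1) ?_
      rw [cochainMap_d, hφ, h1, map_zero]
    refine ⟨cls φ hc, ?_⟩
    rw [cohomologyMap_cls, ← cls_average a (fun g => ha g k) hψ, cls_eq_cls, hφ, sub_self]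
    exact zero_mem _

end Transfer

/-! ### Quotient coverings by finite groups -/

section Covering

variable {X Y : Type} [TopologicalSpace X] [TopologicalSpace Y]

theorem toSSetObjEquiv_singularMap (f : C(X, Y)) (k : SimplexCategoryᵒᵖ)
    (σ : (TopCat.toSSet.obj (TopCat.of X)).obj k) :
    TopCat.toSSetObjEquiv _ k ((singularMap f).app k σ) =
      f.comp (TopCat.toSSetObjEquiv (TopCat.of X) k σ) := rfl

/-- Maps from a standard simplex lift through covering maps. -/
theorem _root_.IsCoveringMap.exists_lift_stdSimplex {p : X → Y} (hp : IsCoveringMap p)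
    (hs : Function.Surjective p) {m : ℕ} (σ : C(stdSimplex ℝ (Fin (m + 1)), Y)) :
    ∃ τ : C(stdSimplex ℝ (Fin (m + 1)), X), p ∘ τ = σ := by
  let v : stdSimplex ℝ (Fin (m + 1)) := ⟨Pi.single 0 1, single_mem_stdSimplex ℝ 0⟩
  obtain ⟨e, he⟩ := hs (σ v)
  -- The straight-line contraction of the simplex to the vertex `v`. At time 0 the map σ ∘ c is
  -- constant and lifts to `e`; the time 1 end of the lifted homotopy lifts σ.
  let c : C(unitInterval × stdSimplex ℝ (Fin (m + 1)), stdSimplex ℝ (Fin (m + 1))) :=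
    ⟨fun x => ⟨(1 - x.1.1) • v.1 + x.1.1 • x.2.1, convex_stdSimplex ℝ _ v.2 x.2.2
      (sub_nonneg.2 x.1.2.2) x.1.2.1 (by ring)⟩, by fun_prop⟩
  have h0 : ∀ a, (σ.comp c) (0, a) = p ((ContinuousMap.const _ e) a) := by
    intro a
    simp only [ContinuousMap.comp_apply, ContinuousMap.const_apply, he]
    congr 1
    ext i
    simp [c]
  refine ⟨(hp.liftHomotopy (σ.comp c) (.const _ e) h0).comp (.prodMk (.const _ 1) (.id _)), ?_⟩
  funext a
  refine (congrFun (hp.liftHomotopy_lifts (σ.comp c) (.const _ e) h0) (1, a)).trans ?_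
  change σ (c (1, a)) = σ a
  congr 1
  ext i
  simp [c]

variable {G : Type} [Group G] [Finite G] [MulAction G X]

/-- Translation by a group element. -/
def smulMap [ContinuousConstSMul G X] (g : G) : C(X, X) := ⟨(g • ·), continuous_const_smul g⟩

/-- The quotient map by a free action of a finite group that is trivial on rational cohomology is
an isomorphism on rational cohomology. -/
theorem bijective_pullback_of_isQuotientCoveringMap [ContinuousConstSMul G X] {p : C(X, Y)}
    (hp : IsQuotientCoveringMap p G)
    (htriv : ∀ (g : G) k, pullback (smulMap g : C(X, X)) k = .id) (k : ℕ) :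
    Function.Bijective (pullback p k) := by
  cases nonempty_fintype G
  refine bijective_cohomologyMap_of_orbits (G := G) (singularMap p)
    (fun g => singularMap (smulMap g)) ?_ ?_ ?_ ?_ htriv k
  · intro g h
    refine (TopCat.toSSet.map_comp _ _).symm.trans (congrArg TopCat.toSSet.map ?_)
    ext x
    exact (mul_smul g h x).symm
  · intro g
    refine (TopCat.toSSet.map_comp _ _).symm.trans (congrArg TopCat.toSSet.map ?_)
    ext x
    exact hp.map_smul g
  · intro k σ
    obtain ⟨τ, hτ⟩ := hp.isCoveringMap.exists_lift_stdSimplex hp.surjective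
      (TopCat.toSSetObjEquiv _ k σ)
    refine ⟨(TopCat.toSSetObjEquiv (TopCat.of X) k).symm τ, ?_⟩
    apply (TopCat.toSSetObjEquiv _ k).injective
    rw [toSSetObjEquiv_singularMap, Equiv.apply_symm_apply]
    exact DFunLike.coe_injective hτ
  · intro k τ τ' h
    have h' := congrArg (TopCat.toSSetObjEquiv _ k) h
    rw [toSSetObjEquiv_singularMap, toSSetObjEquiv_singularMap] at h'
    let v : stdSimplex ℝ (Fin (k.unop.len + 1)) := ⟨Pi.single 0 1, single_mem_stdSimplex ℝ 0⟩
    obtain ⟨g, hg⟩ := hp.apply_eq_iff_mem_orbit.1 (DFunLike.congr_fun h' v).symm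
    refine ⟨g, ?_⟩
    apply (TopCat.toSSetObjEquiv _ k).injective
    rw [toSSetObjEquiv_singularMap]
    -- Both sides lift the same simplex and agree at the vertex `v`, so they agree because a simplex
    -- is connected.
    refine DFunLike.coe_injective (hp.isCoveringMap.eq_of_comp_eq (ContinuousMap.continuous _)
      (ContinuousMap.continuous _) ?_ v hg)
    funext x
    exact (hp.map_smul g).trans (DFunLike.congr_fun h' x)

end Covering

end SingularCohomology

/-! ### Gram–Schmidt and the deformation of W(n)_{>0} onto SO(n) -/

open InnerProductSpace in
/-- The Gram–Schmidt process depends continuously on linearly independent vectors. -/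
theorem continuous_gramSchmidt {A ι E : Type*} [TopologicalSpace A] [LinearOrder ι]
    [LocallyFiniteOrderBot ι] [WellFoundedLT ι] [NormedAddCommGroup E] [InnerProductSpace ℝ E]
    {f : A → ι → E} (hf : ∀ i, Continuous fun a => f a i)
    (hli : ∀ a, LinearIndependent ℝ (f a)) (j : ι) :
    Continuous fun a => gramSchmidt ℝ (f a) j := by
  induction j using WellFoundedLT.induction with
  | ind j ih =>
    simp only [gramSchmidt_def ℝ (f _) j, Submodule.starProjection_singleton]
    refine (hf j).sub (continuous_finsetSum _ fun i hi => ?_)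
    have hi' := ih i (Finset.mem_Iio.1 hi)
    refine Continuous.smul (Continuous.div (hi'.inner (hf j)) ?_ fun a => ?_) hi'
    · exact RCLike.continuous_ofReal.comp (hi'.norm.pow 2)
    · simpa using gramSchmidt_ne_zero i (hli a)

open InnerProductSpace in
theorem real_inner_gramSchmidt_self {ι E : Type*} [LinearOrder ι]
    [LocallyFiniteOrderBot ι] [WellFoundedLT ι] [NormedAddCommGroup E] [InnerProductSpace ℝ E]
    (f : ι → E) (j : ι) : inner ℝ (gramSchmidt ℝ f j) (f j) = ‖gramSchmidt ℝ f j‖ ^ 2 := by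
  conv_lhs => rw [gramSchmidt_def'' ℝ f j]
  rw [inner_add_right, inner_sum, Finset.sum_eq_zero, add_zero, real_inner_self_eq_norm_sq]
  intro i hi
  rw [inner_smul_right, gramSchmidt_orthogonal ℝ f (Finset.mem_Iio.1 hi).ne', mul_zero]

namespace UnitColumns

variable {n : ℕ}

/-- The columns of a matrix as vectors of Euclidean space. -/
def cols (B : Matrix (Fin n) (Fin n) ℝ) (j : Fin n) : EuclideanSpace ℝ (Fin n) :=
  WithLp.toLp 2 (B.col j)

theorem continuous_cols (j : Fin n) :
    Continuous fun B : Matrix (Fin n) (Fin n) ℝ => cols B j := by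
  unfold cols
  exact (PiLp.continuous_toLp 2 _).comp (continuous_pi fun i => by
    simpa using continuous_id.matrix_elem i j)

theorem transpose_mul_apply_eq_inner (M N : Matrix (Fin n) (Fin n) ℝ) (i j : Fin n) :
    (M.transpose * N) i j = inner ℝ (cols M i) (cols N j) := by
  simp [Matrix.mul_apply, cols, PiLp.inner_apply, mul_comm]

theorem linearIndependent_cols {B : Matrix (Fin n) (Fin n) ℝ} (hB : B.det ≠ 0) :
    LinearIndependent ℝ (cols B) := by
  have h := Matrix.linearIndependent_cols_of_det_ne_zero hB
  exact h.map' (WithLp.linearEquiv 2 ℝ (Fin n → ℝ)).symm.toLinearMap (LinearEquiv.ker _)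

theorem norm_cols_pos {B : Matrix (Fin n) (Fin n) ℝ} (hB : B.det ≠ 0) (j : Fin n) :
    0 < ‖cols B j‖ :=
  norm_pos_iff.2 ((linearIndependent_cols hB).ne_zero j)

/-- Rescaling the columns of a matrix of positive determinant to unit length. -/
def normalizeCols : C({B : Matrix (Fin n) (Fin n) ℝ // 0 < B.det}, WPos n) where
  toFun B := ⟨B.1 * Matrix.diagonal fun j => ‖cols B.1 j‖⁻¹, fun j => by
      have e : WithLp.toLp 2 ((B.1 * Matrix.diagonal fun j => ‖cols B.1 j‖⁻¹).col j) =
          ‖cols B.1 j‖⁻¹ • cols B.1 j := by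
        ext i
        simp [cols, mul_comm]
      rw [e, norm_smul, norm_inv, norm_norm, inv_mul_cancel₀ (norm_cols_pos B.2.ne' j).ne'], by
      rw [Matrix.det_mul, Matrix.det_diagonal]
      exact mul_pos B.2 (Finset.prod_pos fun j _ => inv_pos.2 (norm_cols_pos B.2.ne' j))⟩
  continuous_toFun := by
    refine Continuous.subtype_mk (continuous_subtype_val.mul (Continuous.matrix_diagonal
      (continuous_pi fun j => ?_))) _
    exact ((continuous_cols j).comp continuous_subtype_val).norm.inv₀ fun B =>
      (norm_cols_pos B.2.ne' j).ne'

theorem normalizeCols_of_mem_W (B : {B : Matrix (Fin n) (Fin n) ℝ // 0 < B.det}) (hB : B.1 ∈ W n) :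
    (normalizeCols B).1 = B.1 := by
  have : (fun j => ‖cols B.1 j‖⁻¹) = fun _ => 1 := by
    funext j
    rw [show ‖cols B.1 j‖ = 1 from hB j, inv_one]
  simp [normalizeCols, this]

open InnerProductSpace

/-- The matrix whose columns are obtained from those of `B` by the Gram–Schmidt process. -/
def orthonormalize (B : Matrix (Fin n) (Fin n) ℝ) : Matrix (Fin n) (Fin n) ℝ :=
  .of fun i j => gramSchmidtNormed ℝ (cols B) j i

theorem cols_orthonormalize (B : Matrix (Fin n) (Fin n) ℝ) (j : Fin n) :
    cols (orthonormalize B) j = gramSchmidtNormed ℝ (cols B) j := by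
  ext i
  rfl

theorem transpose_orthonormalize_mul_self {B : Matrix (Fin n) (Fin n) ℝ} (hB : B.det ≠ 0) :
    (orthonormalize B).transpose * orthonormalize B = 1 := by
  ext i j
  rw [transpose_mul_apply_eq_inner, cols_orthonormalize, cols_orthonormalize, Matrix.one_apply]
  exact orthonormal_iff_ite.1 (gramSchmidtNormed_orthonormal (linearIndependent_cols hB)) i j

/-- This is the R factor of the QR decomposition: each column of B is orthogonal to the later
Gram–Schmidt vectors. -/
theorem transpose_orthonormalize_mul_isUpperTriangular (B : Matrix (Fin n) (Fin n) ℝ) :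
    ((orthonormalize B).transpose * B).IsUpperTriangular := by
  intro i j (hij : j < i)
  rw [transpose_mul_apply_eq_inner, cols_orthonormalize, gramSchmidtNormed, inner_smul_left,
    gramSchmidt_inv_triangular ℝ _ hij, mul_zero]

theorem transpose_orthonormalize_mul_diag_pos {B : Matrix (Fin n) (Fin n) ℝ} (hB : B.det ≠ 0)
    (j : Fin n) : 0 < ((orthonormalize B).transpose * B) j j := by
  have h := norm_pos_iff.2 (gramSchmidt_ne_zero j (linearIndependent_cols hB))
  rw [transpose_mul_apply_eq_inner, cols_orthonormalize, gramSchmidtNormed, inner_smul_left,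
    real_inner_gramSchmidt_self]
  simp only [map_inv₀, RCLike.ofReal_real_eq_id, id, conj_trivial]
  positivity

theorem det_transpose_orthonormalize_mul_pos {B : Matrix (Fin n) (Fin n) ℝ} (hB : B.det ≠ 0) :
    0 < ((orthonormalize B).transpose * B).det := by
  rw [Matrix.det_of_isUpperTriangular (transpose_orthonormalize_mul_isUpperTriangular B)]
  exact Finset.prod_pos fun j _ => transpose_orthonormalize_mul_diag_pos hB j

theorem det_orthonormalize {B : Matrix (Fin n) (Fin n) ℝ} (hB : 0 < B.det) :
    (orthonormalize B).det = 1 := by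
  have h := det_transpose_orthonormalize_mul_pos hB.ne'
  have h' := congrArg Matrix.det (transpose_orthonormalize_mul_self hB.ne')
  rw [Matrix.det_mul, Matrix.det_transpose] at h
  rw [Matrix.det_mul, Matrix.det_transpose, Matrix.det_one] at h'
  have : 0 < (orthonormalize B).det := pos_of_mul_pos_left h hB.le
  -- The determinant has square 1 by orthogonality and is positive because det(QᵀB) and det B are.
  nlinarith

/-- Multiplying by Qᵀ, of determinant 1, turns the segment into one from an upper triangular matrix
with positive diagonal to the identity. Such matrices form a convex set. -/
theorem det_lineMap_orthonormalize_pos {B : Matrix (Fin n) (Fin n) ℝ} (hB : 0 < B.det) {t : ℝ}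
    (ht : t ∈ unitInterval) : 0 < ((1 - t) • B + t • orthonormalize B).det := by
  have e : (orthonormalize B).transpose * ((1 - t) • B + t • orthonormalize B) =
      (1 - t) • ((orthonormalize B).transpose * B) + t • 1 := by
    rw [mul_add, mul_smul_comm, mul_smul_comm, transpose_orthonormalize_mul_self hB.ne']
  have hpos : 0 < ((1 - t) • ((orthonormalize B).transpose * B) +
      t • (1 : Matrix (Fin n) (Fin n) ℝ)).det := by
    rw [Matrix.det_of_isUpperTriangular]
    · refine Finset.prod_pos fun j _ => ?_
      have h := transpose_orthonormalize_mul_diag_pos hB.ne' j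
      simp only [Matrix.add_apply, Matrix.smul_apply, Matrix.one_apply_eq, smul_eq_mul, mul_one]
      rcases ht.1.eq_or_lt with h0 | h0
      · simpa [← h0] using h
      · have := mul_nonneg (sub_nonneg.2 ht.2) h.le
        linarith
    · intro i j (hij : j < i)
      rw [Matrix.add_apply, Matrix.smul_apply, Matrix.smul_apply,
        transpose_orthonormalize_mul_isUpperTriangular B hij, Matrix.one_apply_ne hij.ne']
      simp
  rwa [← e, Matrix.det_mul, Matrix.det_transpose, det_orthonormalize hB, one_mul] at hpos

theorem continuous_orthonormalize :
    Continuous fun B : WPos n => orthonormalize B.1 := by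
  have hli : ∀ B : WPos n, LinearIndependent ℝ (cols B.1) := fun B =>
    linearIndependent_cols B.2.2.ne'
  have hc : ∀ j, Continuous fun B : WPos n => gramSchmidt ℝ (cols B.1) j :=
    continuous_gramSchmidt (fun j => (continuous_cols j).comp continuous_subtype_val) hli
  refine continuous_matrix fun i j => ?_
  have : Continuous fun B : WPos n => gramSchmidtNormed ℝ (cols B.1) j := by
    unfold gramSchmidtNormed
    exact ((hc j).norm.inv₀ fun B => norm_ne_zero_iff.2 (gramSchmidt_ne_zero j (hli B))).smul (hc j)
  exact (PiLp.continuous_apply 2 _ i).comp this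

/-- The retraction of `W(n)_{>0}` onto the special orthogonal group. -/
def retract : C(WPos n, Matrix.specialOrthogonalGroup (Fin n) ℝ) where
  toFun B := ⟨orthonormalize B.1, Matrix.mem_specialOrthogonalGroup_iff.2
    ⟨(Matrix.mem_orthogonalGroup_iff' _ _).2 (transpose_orthonormalize_mul_self B.2.2.ne'),
      det_orthonormalize B.2.2⟩⟩
  continuous_toFun := continuous_orthonormalize.subtype_mk _

theorem mem_W_of_mem_specialOrthogonalGroup {A : Matrix (Fin n) (Fin n) ℝ}
    (hA : A ∈ Matrix.specialOrthogonalGroup (Fin n) ℝ) : A ∈ W n := by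
  intro j
  have h := (Matrix.mem_orthogonalGroup_iff' _ _).1 (Matrix.mem_specialOrthogonalGroup_iff.1 hA).1
  have h' := congrFun (congrFun h j) j
  rw [transpose_mul_apply_eq_inner, Matrix.one_apply_eq, real_inner_self_eq_norm_sq] at h'
  exact (pow_eq_one_iff_of_nonneg (norm_nonneg _) two_ne_zero).1 h'

/-- The inclusion of the special orthogonal group into `W(n)_{>0}`. -/
def incl : C(Matrix.specialOrthogonalGroup (Fin n) ℝ, WPos n) where
  toFun A := ⟨A.1, mem_W_of_mem_specialOrthogonalGroup A.2, by
    rw [(Matrix.mem_specialOrthogonalGroup_iff.1 A.2).2]; exact one_pos⟩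
  continuous_toFun := continuous_subtype_val.subtype_mk _

theorem retract_incl : (retract (n := n)).comp incl = .id _ := by
  ext A : 2
  have h := (Matrix.mem_orthogonalGroup_iff' _ _).1
    (Matrix.mem_specialOrthogonalGroup_iff.1 A.2).1
  have hgs : gramSchmidt ℝ (cols A.1) = cols A.1 := gramSchmidt_of_orthogonal ℝ fun i j hij => by
    beta_reduce
    rw [← transpose_mul_apply_eq_inner, h, Matrix.one_apply_ne hij]
  ext i j
  have h1 : ‖cols A.1 j‖ = 1 := mem_W_of_mem_specialOrthogonalGroup A.2 j
  change gramSchmidtNormed ℝ (cols A.1) j i = A.1 i j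
  rw [gramSchmidtNormed, hgs, h1]
  simp [cols]

/-- The linear segment leaves the unit-column matrices but keeps positive determinant. Normalizing
the columns brings it back and fixes both endpoints, whose columns are already unit vectors. -/
theorem incl_retract_homotopic : (ContinuousMap.id (WPos n)).Homotopic (incl.comp retract) := by
  let c : C(unitInterval × WPos n, {B : Matrix (Fin n) (Fin n) ℝ // 0 < B.det}) :=
    ⟨fun x => ⟨(1 - x.1.1) • x.2.1 + x.1.1 • orthonormalize x.2.1,
      det_lineMap_orthonormalize_pos x.2.2.2 x.1.2⟩, by
      have := (continuous_orthonormalize (n := n)).comp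
        (continuous_snd (X := unitInterval) (Y := WPos n))
      refine Continuous.subtype_mk ?_ _
      have h1 : Continuous fun x : unitInterval × WPos n => x.1.1 := by fun_prop
      have h2 : Continuous fun x : unitInterval × WPos n => x.2.1 := by fun_prop
      exact ((continuous_const.sub h1).smul h2).add (h1.smul this)⟩
  refine ⟨⟨normalizeCols.comp c, fun B => Subtype.ext ?_, fun B => Subtype.ext ?_⟩⟩
  · have e : (c (0, B)).1 = B.1 := by simp [c]
    exact (normalizeCols_of_mem_W _ (e ▸ B.2.1)).trans e
  · have e : (c (1, B)).1 = (incl (retract B)).1 := by simp [c, incl, retract]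
    exact (normalizeCols_of_mem_W _ (e ▸ (incl (retract B)).2.1)).trans e

end UnitColumns

/-! ### Paths in SO(n) from signed permutations to the identity -/

namespace UnitColumns

variable {n : ℕ}

/-- The reflection `1 - 2 v vᵀ / (vᵀ v)`. -/
def householder (v : Fin n → ℝ) : Matrix (Fin n) (Fin n) ℝ :=
  1 - (2 / (v ⬝ᵥ v)) • Matrix.vecMulVec v v

theorem householder_mul_self {v : Fin n → ℝ} (hv : v ≠ 0) : householder v * householder v = 1 := by
  have h : v ⬝ᵥ v ≠ 0 := by simpa using hv
  have h1 : Matrix.vecMulVec v v * Matrix.vecMulVec v v = (v ⬝ᵥ v) • Matrix.vecMulVec v v := by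
    ext i j
    simp only [Matrix.mul_apply, Matrix.vecMulVec_apply, Matrix.smul_apply, smul_eq_mul,
      dotProduct, Finset.sum_mul]
    exact Finset.sum_congr rfl fun k _ => by ring
  rw [householder, mul_sub, mul_one, sub_mul, one_mul, smul_mul_smul_comm, h1, smul_smul,
    show 2 / (v ⬝ᵥ v) * (2 / (v ⬝ᵥ v)) * (v ⬝ᵥ v) = 2 / (v ⬝ᵥ v) + 2 / (v ⬝ᵥ v) by
      field_simp; norm_num, add_smul]
  abel

theorem transpose_householder (v : Fin n → ℝ) : (householder v).transpose = householder v := by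
  ext i j
  simp [householder, Matrix.vecMulVec_apply, Matrix.one_apply, eq_comm, mul_comm]

/-- The reflection is a rank-one perturbation of the identity, so its determinant is 1 - (2 / (v ⬝ᵥ
v)) (v ⬝ᵥ v). -/
theorem det_householder {v : Fin n → ℝ} (hv : v ≠ 0) : (householder v).det = -1 := by
  have h : v ⬝ᵥ v ≠ 0 := by simpa using hv
  have e : householder v = 1 + Matrix.replicateCol Unit (-(2 / (v ⬝ᵥ v)) • v) *
      Matrix.replicateRow Unit v := by
    ext i j
    simp [householder, Matrix.vecMulVec_apply, Matrix.mul_apply, sub_eq_add_neg, mul_assoc]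
  rw [e, Matrix.det_one_add_replicateCol_mul_replicateRow, dotProduct_smul, smul_eq_mul]
  field_simp
  norm_num

theorem householder_mul_mem {v w : Fin n → ℝ} (hv : v ≠ 0) (hw : w ≠ 0) :
    householder v * householder w ∈ Matrix.specialOrthogonalGroup (Fin n) ℝ := by
  rw [Matrix.mem_specialOrthogonalGroup_iff, Matrix.mem_orthogonalGroup_iff]
  refine ⟨?_, by rw [Matrix.det_mul, det_householder hv, det_householder hw]; norm_num⟩
  change _ * (householder v * householder w).transpose = 1
  rw [Matrix.transpose_mul, transpose_householder, transpose_householder, mul_assoc,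
    ← mul_assoc (householder w), householder_mul_self hw, one_mul, householder_mul_self hv]

/-- Move v to w through nonzero vectors, which is possible since n > 1. The product stays in SO(n)
and ends at the square of a reflection. -/
theorem joinedIn_householder_mul (hn : 1 < n) {v w : Fin n → ℝ} (hv : v ≠ 0) (hw : w ≠ 0) :
    JoinedIn (Matrix.specialOrthogonalGroup (Fin n) ℝ : Set (Matrix (Fin n) (Fin n) ℝ))
      (householder v * householder w) 1 := by
  have hrank : 1 < Module.rank ℝ (Fin n → ℝ) := by simpa using hn
  obtain ⟨γ, hγ⟩ := (isPathConnected_compl_singleton_of_one_lt_rank hrank 0).joinedIn v hv w hw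
  have hγ' : ∀ t, γ t ≠ 0 := hγ
  have hc : Continuous fun t => householder (γ t) * householder w := by
    unfold householder
    refine Continuous.mul (continuous_const.sub (Continuous.smul (continuous_const.div
      (γ.continuous.dotProduct γ.continuous) fun t => by simpa using hγ' t)
      (γ.continuous.matrix_vecMulVec γ.continuous))) continuous_const
  exact ⟨⟨⟨_, hc⟩, by simp, by simp [householder_mul_self hw]⟩,
    fun t => householder_mul_mem (hγ' t) hw⟩

/-- Products of reflections. -/
def reflectionMonoid (n : ℕ) : Submonoid (Matrix (Fin n) (Fin n) ℝ) :=
  Submonoid.closure (householder '' {v | v ≠ 0})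

theorem joinedIn_mul {M N : Matrix (Fin n) (Fin n) ℝ}
    (hM : JoinedIn (Matrix.specialOrthogonalGroup (Fin n) ℝ : Set (Matrix (Fin n) (Fin n) ℝ)) M 1)
    (hN : JoinedIn (Matrix.specialOrthogonalGroup (Fin n) ℝ : Set (Matrix (Fin n) (Fin n) ℝ)) N 1) :
    JoinedIn (Matrix.specialOrthogonalGroup (Fin n) ℝ : Set (Matrix (Fin n) (Fin n) ℝ))
      (M * N) 1 := by
  have h := hM.mul hN
  rw [mul_one] at h
  exact h.mono (Submonoid.coe_mul_self_eq _).subset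

theorem joinedIn_one_of_mem_reflectionMonoid (hn : 1 < n) {M : Matrix (Fin n) (Fin n) ℝ}
    (hM : M ∈ reflectionMonoid n) (hdet : M.det = 1) :
    JoinedIn (Matrix.specialOrthogonalGroup (Fin n) ℝ : Set (Matrix (Fin n) (Fin n) ℝ)) M 1 := by
  let w : Fin n → ℝ := Pi.single ⟨0, by omega⟩ 1
  have hw : w ≠ 0 := by simp [w]
  -- The induction passes through products of odd length, which lie outside SO(n); these are
  -- corrected by the fixed reflection in `w`. The determinant later selects the alternative.
  have key : JoinedIn (Matrix.specialOrthogonalGroup (Fin n) ℝ : Set _) M 1 ∨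
      JoinedIn (Matrix.specialOrthogonalGroup (Fin n) ℝ : Set _) (M * householder w) 1 := by
    clear hdet
    induction hM using Submonoid.closure_induction_right with
    | one => exact .inl (JoinedIn.refl (one_mem _))
    | mul_right x hx y hy ih =>
      obtain ⟨v, hv, rfl⟩ := hy
      rcases ih with ih | ih
      · right
        rw [mul_assoc]
        exact joinedIn_mul ih (joinedIn_householder_mul hn hv hw)
      · left
        have e : x * householder v = x * householder w * (householder w * householder v) := by
          rw [mul_assoc, ← mul_assoc (householder w), householder_mul_self hw, one_mul]
        rw [e]
        exact joinedIn_mul ih (joinedIn_householder_mul hn hw hv)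
  refine key.resolve_right fun h => ?_
  have := (Matrix.mem_specialOrthogonalGroup_iff.1 h.source_mem).2
  rw [Matrix.det_mul, hdet, det_householder hw] at this
  norm_num at this

theorem householder_single (i : Fin n) :
    householder (Pi.single i 1) = Matrix.diagonal (Function.update 1 i (-1)) := by
  ext j k
  rcases eq_or_ne j i with rfl | hj
  · rcases eq_or_ne j k with rfl | hk
    · simp [householder, Matrix.vecMulVec_apply]; norm_num
    · simp [householder, Matrix.vecMulVec_apply, hk, hk.symm]
  · simp [householder, Matrix.vecMulVec_apply, Matrix.diagonal_apply, Matrix.one_apply, hj]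

/-- With `householder_single`, this exhibits the sign changes and transpositions that generate all
signed permutation matrices as reflections. -/
theorem householder_swap {i j : Fin n} (hij : i ≠ j) :
    householder (Pi.single i 1 - Pi.single j 1) = (Equiv.swap i j).permMatrix ℝ := by
  have hd : (Pi.single i 1 - Pi.single j 1 : Fin n → ℝ) ⬝ᵥ (Pi.single i 1 - Pi.single j 1) = 2 := by
    simp [hij, hij.symm]; norm_num
  ext k l
  rw [householder, hd]
  simp only [div_self (two_ne_zero (α := ℝ)), one_smul, Matrix.sub_apply, Matrix.vecMulVec_apply,
    Pi.sub_apply, Equiv.Perm.permMatrix, PEquiv.toMatrix_apply, Equiv.toPEquiv_apply,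
    Option.mem_some_iff, Matrix.one_apply, Pi.single_apply, Equiv.swap_apply_def]
  grind

theorem diagonal_mem_reflectionMonoid (a : Fin n → ℤˣ) :
    Matrix.diagonal (fun i => ((a i : ℤ) : ℝ)) ∈ reflectionMonoid n := by
  -- The signs are switched on one coordinate at a time, each -1 costing one reflection.
  have key : ∀ s : Finset (Fin n),
      Matrix.diagonal (fun i => if i ∈ s then ((a i : ℤ) : ℝ) else 1) ∈ reflectionMonoid n := by
    intro s
    induction s using Finset.induction_on with
    | empty => simp
    | insert i s hi ih =>
      rcases Int.units_eq_one_or (a i) with h | h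
      · convert ih using 3 with j
        rcases eq_or_ne j i with rfl | hj
        · simp [hi, h]
        · simp [hj]
      · have hm : householder (Pi.single i 1) ∈ reflectionMonoid n :=
          Submonoid.subset_closure ⟨_, by simp, rfl⟩
        convert mul_mem hm ih using 1
        rw [householder_single, Matrix.diagonal_mul_diagonal]
        congr 1
        funext j
        rcases eq_or_ne j i with rfl | hj
        · simp [hi, h]
        · simp [hj]
  simpa using key Finset.univ

theorem permMatrix_mem_reflectionMonoid (σ : Equiv.Perm (Fin n)) :
    σ.permMatrix ℝ ∈ reflectionMonoid n := by
  induction σ using Equiv.Perm.swap_induction_on with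
  | one => simp
  | swap_mul f x y hxy ih =>
    rw [Matrix.permMatrix_mul, ← householder_swap hxy]
    refine mul_mem ih (Submonoid.subset_closure ⟨_, fun h => ?_, rfl⟩)
    have := congrFun h x
    simp [hxy] at this

theorem joinedIn_one_of_mem_G₀ (hn : 1 < n) {g : GL (Fin n) ℝ} (hg : g ∈ G₀ n) :
    JoinedIn (Matrix.specialOrthogonalGroup (Fin n) ℝ : Set (Matrix (Fin n) (Fin n) ℝ)) g.1 1 := by
  obtain ⟨⟨a, σ, ha⟩, hdet⟩ := hg
  refine joinedIn_one_of_mem_reflectionMonoid hn ?_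
    (by simpa using congrArg Units.val (MonoidHom.mem_ker.1 hdet))
  rw [ha]
  exact mul_mem (diagonal_mem_reflectionMonoid a) (permMatrix_mem_reflectionMonoid σ)

end UnitColumns

/-! ### The orbit space and the final isomorphism -/

namespace UnitColumns

open SingularCohomology

variable {n : ℕ}

instance : ContinuousConstSMul (G₀ n)ᵐᵒᵖ (WPos n) where
  continuous_const_smul _ := (continuous_subtype_val.mul continuous_const).subtype_mk _

instance : Finite (G₀ n) := by
  refine Finite.of_injective (β := Set.range fun x : (Fin n → ℤˣ) × Equiv.Perm (Fin n) =>
      signedPerm x.1 x.2) (fun g => ⟨g.1.1, ?_⟩) fun g h hgh => ?_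
  · obtain ⟨⟨a, σ, ha⟩, -⟩ := g.2
    exact ⟨(a, σ), ha.symm⟩
  · exact Subtype.ext (Units.ext (congrArg Subtype.val hgh))

instance : Finite (G₀ n)ᵐᵒᵖ := Finite.of_equiv _ MulOpposite.opEquiv

/-- Freeness of the action: B is invertible and can be cancelled on the left. -/
instance : IsCancelSMul (G₀ n)ᵐᵒᵖ (WPos n) where
  right_cancel' g h B e := by
    have e' : B.1 * g.unop.1.1 = B.1 * h.unop.1.1 := congrArg Subtype.val e
    have hB : IsUnit B.1 := (Matrix.isUnit_iff_isUnit_det _).2 B.2.2.ne'.isUnit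
    exact MulOpposite.unop_injective (Subtype.ext (Units.ext (hB.mul_left_cancel e')))

instance : LocallyCompactSpace (WPos n) := by
  have h1 : IsClosed (W n) := by
    have : W n = ⋂ j, {B | ‖cols B j‖ = 1} := by
      ext B
      simp [W, cols]
    rw [this]
    exact isClosed_iInter fun j => isClosed_eq (continuous_cols j).norm continuous_const
  have h2 : IsOpen {B : Matrix (Fin n) (Fin n) ℝ | 0 < B.det} :=
    isOpen_lt continuous_const continuous_id.matrix_det
  have : LocallyCompactSpace (Matrix (Fin n) (Fin n) ℝ) :=
    inferInstanceAs (LocallyCompactSpace (Fin n → Fin n → ℝ))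
  exact (h1.isLocallyClosed.inter h2.isLocallyClosed).locallyCompactSpace

/-- The projection to the orbit space. -/
def orbitProj : C(WPos n, WPosQuot n) := ⟨Quotient.mk _, continuous_quotient_mk'⟩

theorem isQuotientCoveringMap_orbitProj :
    IsQuotientCoveringMap (orbitProj (n := n)) (G₀ n)ᵐᵒᵖ := by
  -- Automatic for a finite group: every set of group elements is finite.
  have : ProperlyDiscontinuousSMul (G₀ n)ᵐᵒᵖ (WPos n) := ⟨fun _ _ => Set.toFinite _⟩
  exact isQuotientCoveringMap_quotientMk_of_properlyDiscontinuousSMul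

theorem bijective_pullback_incl (k : ℕ) :
    Function.Bijective (pullback (incl (n := n)) k) := by
  refine Function.bijective_iff_has_inverse.2 ⟨pullback retract k, fun a => ?_, fun a => ?_⟩
  · rw [← pullback_comp, ← pullback_eq_of_homotopic incl_retract_homotopic, pullback_id]
  · rw [← pullback_comp, retract_incl, pullback_id]

/-- A path from g to 1 in SO(n) deforms right translation by g to the identity. The homotopy is
built on SO(n) only, since right multiplication by an arbitrary rotation need not keep columns of
unit length. Injectivity of the pullback along `incl` carries the conclusion over to W(n)_{>0}. -/
theorem pullback_smulMap (hn : 1 < n) (g : (G₀ n)ᵐᵒᵖ) (k : ℕ) :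
    pullback (smulMap g : C(WPos n, WPos n)) k = .id := by
  obtain ⟨γ, hγ⟩ := joinedIn_one_of_mem_G₀ hn g.unop.2
  let H : C(unitInterval × Matrix.specialOrthogonalGroup (Fin n) ℝ, WPos n) :=
    incl.comp ⟨fun x => ⟨x.2.1 * γ x.1, mul_mem x.2.2 (hγ x.1)⟩,
      ((continuous_subtype_val.comp continuous_snd).mul
        (γ.continuous.comp continuous_fst)).subtype_mk _⟩
  have h : ((smulMap g : C(WPos n, WPos n)).comp incl).Homotopic incl := by
    refine ⟨⟨H, fun A => Subtype.ext ?_, fun A => Subtype.ext ?_⟩⟩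
    · exact congrArg (A.1 * ·) γ.source
    · exact (congrArg (A.1 * ·) γ.target).trans (mul_one _)
  refine LinearMap.ext fun a => (bijective_pullback_incl k).1 ?_
  rw [← pullback_comp, pullback_eq_of_homotopic h]
  rfl

theorem bijective_pullback_orbitProj_comp_incl (hn : 1 < n) (k : ℕ) :
    Function.Bijective (pullback ((orbitProj (n := n)).comp incl) k) := by
  have e : ⇑(pullback ((orbitProj (n := n)).comp incl) k) =
      pullback incl k ∘ pullback orbitProj k := funext fun a => pullback_comp _ _ k a
  rw [e]
  exact (bijective_pullback_incl k).comp
    (bijective_pullback_of_isQuotientCoveringMap isQuotientCoveringMap_orbitProj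
      (pullback_smulMap hn) k)

end UnitColumns
end

theorem mainTheorem9 (n : ℕ) (hn : 1 < n) :
    ∃ e : ∀ k : ℕ, SingularCohomology.RatCohomology (UnitColumns.WPosQuot n) k ≃ₗ[ℚ]
        SingularCohomology.RatCohomology (Matrix.specialOrthogonalGroup (Fin n) ℝ) k,
      e 0 (SingularCohomology.unit _ _) = SingularCohomology.unit _ _ ∧
      ∀ (p q : ℕ) (a : SingularCohomology.RatCohomology (UnitColumns.WPosQuot n) p)
        (b : SingularCohomology.RatCohomology (UnitColumns.WPosQuot n) q),
        e (p + q) (SingularCohomology.cup a b) = SingularCohomology.cup (e p a) (e q b) := by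
  exact ⟨fun k => LinearEquiv.ofBijective _ (UnitColumns.bijective_pullback_orbitProj_comp_incl hn k),
      SingularCohomology.pullback_unit _, fun _ _ a b => SingularCohomology.pullback_cup _ a b⟩
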